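/- Conventions. For a frame $F$, let $\mathsf{M}F$ be the frame presented by generators $\Box a,\Diamond a$ ($a\in F$) and the relations $$\Box(a\wedge b)\le\Box a,\qquad \Box a\wedge\Diamond b=\bot\ \text{ if } a\wedge b=\bot,\qquad \Box\bigvee A=\bigvee_{a\in A}\Box a,$$ $$\Diamond a\le\Diamond(a\vee b),\qquad \Box a\vee\Diamond b=\top\ \text{ if } a\vee b=\top,\qquad \Diamond\bigvee A=\bigvee_{a\in A}\Diamond a,$$ where $a,b\in F$ and $A\subseteq F$ is non-empty and directed; for a frame homomorphism $f:F\to F'$ let $\mathsf{M}f$ be given by $\Box a\mapsto\Box f(a)$, $\Diamond a\mapsto\Diamond f(a)$. The functor $\mathsf{M}$ restricts to an endofunctor $\mathsf{M}_{\mathrm{kr}}$ of the category $\mathbf{KRFrm}$ of compact regular frames and frame homomorphisms. For a compact Hausdorff space $X$, let $\mathsf{D}_{\mathrm{kh}}X$ be the set of all $W\subseteq\mathcal{P}X$ such that, for every $u\subseteq X$, $u\in W$ iff there is a closed $c\subseteq u$ all of whose open supersets belong to $W$, with the topology generated by the sets $\boxplus a=\{W\mid a\in W\}$ and $\boxtimes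 a=\{W\mid X\setminus a\notin W\}$, $a\subseteq X$ open; for a continuous map $f:X\to X'$ let $\mathsf{D}_{\mathrm{kh}}f(W)=\{a\subseteq X'\mid f^{-1}(a)\in W\}$. This is an endofunctor of the category $\mathbf{KHaus}$ of compact Hausdorff spaces and continuous maps. Let $\mathsf{opn}:\mathbf{KHaus}^{\mathrm{op}}\to\mathbf{KRFrm}$ send a space to its frame of open sets and a continuous map $f$ to $f^{-1}$. **Theorem.** There is a natural isomorphism $\eta:\mathsf{M}_{\mathrm{kr}}\circ\mathsf{opn}\to\mathsf{opn}\circ\mathsf{D}_{\mathrm{kh}}$ of functors $\mathbf{KHaus}^{\mathrm{op}}\to\mathbf{KRFrm}$ with $\eta_X(\Box a)=\boxplus a$ and $\eta_X(\Diamond a)=\boxtimes a$ for every compact Hausdorff space $X$ and open $a\subseteq X$. Moreover, the functor that sends a $\mathsf{D}_{\mathrm{kh}}$-coalgebra $\gamma:X\to\mathsf{D}_{\mathrm{kh}}X$ to the $\mathsf{M}_{\mathrm{kr}}$-algebra $\mathsf{opn}(\gamma)\circ\eta_X:\mathsf{M}_{\mathrm{kr}}(\mathsf{opn}X)\to\mathsf{opn}X$,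 and a coalgebra morphism $f$ to $\mathsf{opn}f=f^{-1}$, is part of an equivalence of categories $$\mathbf{Coalg}(\mathsf{D}_{\mathrm{kh}})^{\mathrm{op}}\simeq\mathbf{Alg}(\mathsf{M}_{\mathrm{kr}}).$$ In particular, $\mathbf{Alg}(\mathsf{M}_{\mathrm{kr}})$ is dually equivalent to $\mathbf{Coalg}(\mathsf{D}_{\mathrm{kh}})$. -/

import Mathlib

universe u v

open CategoryTheory TopologicalSpace Opposite

/-! ### Frames presented by generators and relations -/

section Presentation

/-- The free frame on a set `G` of generators. The finite subsets of `G`, ordered by reverse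
inclusion, form the free meet-semilattice on `G`, and its lower sets form the free frame: the lower
set `U` stands for the join, over `s ∈ U`, of the finite meets of the elements of `s`. -/
abbrev FreeFrame (G : Type u) : Type u := LowerSet (Finset G)ᵒᵈ

/-- The inclusion of generators into the free frame. -/
def FreeFrame.gen {G : Type u} (g : G) : FreeFrame G := LowerSet.Iic (OrderDual.toDual {g})

theorem FreeFrame.mem_gen {G : Type u} (g : G) (s : (Finset G)ᵒᵈ) :
    s ∈ FreeFrame.gen g ↔ g ∈ OrderDual.ofDual s := by
  unfold FreeFrame.gen
  rw [LowerSet.mem_Iic_iff]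
  exact Finset.singleton_subset_iff

theorem FreeFrame.mem_finset_inf_gen {G : Type u} (s : Finset G) (t : (Finset G)ᵒᵈ) :
    t ∈ s.inf FreeFrame.gen ↔ s ⊆ OrderDual.ofDual t := by
  classical
  induction s using Finset.induction_on with
  | empty => simp
  | insert a s ha ih =>
    rw [Finset.inf_insert, LowerSet.mem_inf_iff, ih, FreeFrame.mem_gen, Finset.insert_subset_iff]

theorem FreeFrame.eq_sSup {G : Type u} (U : FreeFrame G) :
    U = ⨆ s ∈ U, (OrderDual.ofDual s).inf FreeFrame.gen := by
  ext t
  simp only [SetLike.mem_coe, LowerSet.mem_iSup_iff, FreeFrame.mem_finset_inf_gen]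
  constructor
  · intro h
    exact ⟨t, h, subset_rfl⟩
  · rintro ⟨s, hs, hst⟩
    exact U.lower hst hs

/-- The value of an expression of the free frame under an assignment of the generators: the
extension of the assignment to a frame homomorphism. -/
def FreeFrame.lift {G : Type u} {L : Type v} [Order.Frame L] (f : G → L) :
    FrameHom (FreeFrame G) L where
  toFun U := ⨆ s ∈ U, (OrderDual.ofDual s).inf f
  map_inf' U V := by
    classical
    apply le_antisymm
    · refine iSup₂_le fun s hs => le_inf ?_ ?_
      · exact le_iSup₂ (f := fun s (_ : s ∈ U) => (OrderDual.ofDual s).inf f) s hs.1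
      · exact le_iSup₂ (f := fun s (_ : s ∈ V) => (OrderDual.ofDual s).inf f) s hs.2
    · simp only [iSup_inf_eq, inf_iSup_eq]
      refine iSup₂_le fun s hs => iSup₂_le fun t ht => ?_
      rw [← Finset.inf_union]
      refine le_iSup₂ (f := fun s (_ : s ∈ U ⊓ V) => (OrderDual.ofDual s).inf f)
        (OrderDual.toDual (OrderDual.ofDual t ∪ OrderDual.ofDual s)) ?_
      exact ⟨U.lower (Finset.subset_union_left) ht, V.lower (Finset.subset_union_right) hs⟩
  map_top' := by
    refine top_le_iff.1 ?_
    refine le_trans ?_ (le_iSup₂ (f := fun s (_ : s ∈ (⊤ : FreeFrame G)) =>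
      (OrderDual.ofDual s).inf f) (OrderDual.toDual ∅) (LowerSet.mem_top))
    simp
  map_sSup' S := by
    apply le_antisymm
    · refine iSup₂_le fun s hs => ?_
      obtain ⟨U, hU, hsU⟩ := LowerSet.mem_sSup_iff.1 hs
      refine le_trans ?_ (le_sSup (Set.mem_image_of_mem _ hU))
      exact le_iSup₂ (f := fun s (_ : s ∈ U) => (OrderDual.ofDual s).inf f) s hsU
    · refine sSup_le ?_
      rintro _ ⟨U, hU, rfl⟩
      refine iSup₂_le fun s hs => ?_
      exact le_iSup₂ (f := fun s (_ : s ∈ sSup S) => (OrderDual.ofDual s).inf f) s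
        (LowerSet.mem_sSup_iff.2 ⟨U, hU, hs⟩)

theorem FreeFrame.lift_apply {G : Type u} {L : Type v} [Order.Frame L] (f : G → L)
    (U : FreeFrame G) : FreeFrame.lift f U = ⨆ s ∈ U, (OrderDual.ofDual s).inf f := rfl

@[simp]
theorem FreeFrame.lift_gen {G : Type u} {L : Type v} [Order.Frame L] (f : G → L) (g : G) :
    FreeFrame.lift f (FreeFrame.gen g) = f g := by
  rw [FreeFrame.lift_apply]
  apply le_antisymm
  · exact iSup₂_le fun s hs => Finset.inf_le ((FreeFrame.mem_gen g s).1 hs)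
  · refine le_trans ?_ (le_iSup₂ (f := fun s (_ : s ∈ FreeFrame.gen g) =>
      (OrderDual.ofDual s).inf f) (OrderDual.toDual {g}) ((FreeFrame.mem_gen g _).2 (by simp)))
    simp

/-- The quotient of the free frame by a set of relations `l ≤ r`, as a sublocale: an element `x` of
the free frame is kept iff it cannot tell `l ⊓ r` from `l` for any of the relations. -/
def presentedSublocale {G : Type u} (R : FreeFrame G → FreeFrame G → Prop) :
    Sublocale (FreeFrame G) where
  carrier := {x | ∀ l r, R l r → r ⇨ x ≤ l ⇨ x}
  sInf_mem' S hS l r hR := by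
    simp only [le_himp_iff, le_sInf_iff]
    intro x hx
    rw [← le_himp_iff]
    exact (himp_le_himp_left (sInf_le hx)).trans (hS hx l r hR)
  himp_mem' a x hx l r hR := by
    rw [himp_left_comm r, himp_left_comm l]
    exact himp_le_himp_left (hx l r hR)

/-- The frame presented by the generators `G` and the relations `l ≤ r` for `R l r`. -/
abbrev PresentedFrame {G : Type u} (R : FreeFrame G → FreeFrame G → Prop) : Type u :=
  ↥(presentedSublocale R)

namespace PresentedFrame

variable {G : Type u} {R : FreeFrame G → FreeFrame G → Prop} {L : Type v} [Order.Frame L]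

/-- The class in the presented frame of an expression in the generators. -/
def mk (R : FreeFrame G → FreeFrame G → Prop) : FrameHom (FreeFrame G) (PresentedFrame R) :=
  (presentedSublocale R).restrict

/-- The generators of a presented frame. -/
def gen (R : FreeFrame G → FreeFrame G → Prop) (g : G) : PresentedFrame R :=
  mk R (FreeFrame.gen g)

theorem mk_val (x : PresentedFrame R) : mk R x.1 = x :=
  (presentedSublocale R).restrict_of_mem x.2

theorem mk_le_iff (a : FreeFrame G) (x : PresentedFrame R) : mk R a ≤ x ↔ a ≤ x.1 :=
  (presentedSublocale R).giRestrict.gc a x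

/-- The relations hold in the presented frame. -/
theorem mk_le_mk {l r : FreeFrame G} (h : R l r) : mk R l ≤ mk R r := by
  rw [mk_le_iff]
  have h1 : r ≤ (mk R r).1 := (mk_le_iff r _).1 le_rfl
  have h2 := (mk R r).2 l r h
  rw [himp_eq_top_iff.2 h1, top_le_iff, himp_eq_top_iff] at h2
  exact h2

/-- The generators generate the presented frame. -/
theorem eq_iSup (x : PresentedFrame R) :
    x = ⨆ s ∈ x.1, (OrderDual.ofDual s).inf (gen R) := by
  conv_lhs => rw [← mk_val x, FreeFrame.eq_sSup x.1]
  simp only [map_iSup, map_finset_inf]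
  rfl

theorem lift_mk_val (f : G → L)
    (hf : ∀ l r, R l r → FreeFrame.lift f l ≤ FreeFrame.lift f r) (a : FreeFrame G) :
    FreeFrame.lift f (mk R a).1 = FreeFrame.lift f a := by
  apply le_antisymm
  · let y : L := FreeFrame.lift f a
    let w : FreeFrame G := sSup {b | FreeFrame.lift f b ≤ y}
    have hw : ∀ b, b ≤ w ↔ FreeFrame.lift f b ≤ y := by
      intro b
      constructor
      · intro hb
        refine (OrderHomClass.mono (FreeFrame.lift f) hb).trans ?_
        rw [map_sSup]
        refine sSup_le ?_
        rintro _ ⟨c, hc, rfl⟩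
        exact hc
      · intro hb
        exact le_sSup hb
    have hmem : w ∈ presentedSublocale R := by
      intro l r hR
      rw [le_himp_iff, hw, map_inf]
      refine (inf_le_inf_left _ (hf l r hR)).trans ?_
      rw [← map_inf, ← hw]
      exact himp_inf_le
    have h1 : mk R a ≤ ⟨w, hmem⟩ := (mk_le_iff a _).2 ((hw a).2 le_rfl)
    exact (hw _).1 h1
  · exact OrderHomClass.mono (FreeFrame.lift f) ((mk_le_iff a _).1 le_rfl)

/-- The universal property of the presented frame: an assignment of the generators that respects
the relations extends to a frame homomorphism. -/
def lift (f : G → L) (hf : ∀ l r, R l r → FreeFrame.lift f l ≤ FreeFrame.lift f r) :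
    FrameHom (PresentedFrame R) L where
  toFun x := FreeFrame.lift f x.1
  map_inf' x y := map_inf (FreeFrame.lift f) x.1 y.1
  map_top' := map_top (FreeFrame.lift f)
  map_sSup' S := by
    have h : mk R (sSup (Subtype.val '' S)) = sSup S := by
      rw [map_sSup, ← Set.image_comp]
      congr 1
      conv_rhs => rw [← Set.image_id S]
      exact Set.image_congr fun x _ => mk_val x
    rw [← h, lift_mk_val f hf, map_sSup, ← Set.image_comp]
    rfl

@[simp]
theorem lift_gen (f : G → L) (hf : ∀ l r, R l r → FreeFrame.lift f l ≤ FreeFrame.lift f r)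
    (g : G) : lift f hf (gen R g) = f g :=
  (lift_mk_val f hf _).trans (FreeFrame.lift_gen f g)

/-- Homomorphisms out of a presented frame are determined by their values on generators. -/
theorem hom_ext {p q : FrameHom (PresentedFrame R) L} (h : ∀ g, p (gen R g) = q (gen R g)) :
    p = q := by
  ext x
  rw [eq_iSup x]
  simp only [map_iSup, map_finset_inf]
  have : (p : PresentedFrame R → L) ∘ gen R = q ∘ gen R := funext h
  rw [this]

end PresentedFrame

end Presentation

/-! ### Compact regular frames -/

/-- A frame is compact if every family with join `⊤` has a finite subfamily with join `⊤`. -/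
def IsCompactFrame (F : Type u) [Order.Frame F] : Prop :=
  ∀ S : Set F, sSup S = ⊤ → ∃ T : Set F, T ⊆ S ∧ T.Finite ∧ sSup T = ⊤

/-- `a` is well inside `b`. -/
def WellInside {F : Type u} [Order.Frame F] (a b : F) : Prop :=
  ∃ c : F, c ⊓ a = ⊥ ∧ c ⊔ b = ⊤

/-- A frame is regular if each element is the join of the elements well inside it. -/
def IsRegularFrame (F : Type u) [Order.Frame F] : Prop :=
  ∀ a : F, a = sSup {b : F | WellInside b a}

/-- The property of frames of being compact and regular. -/
def isCompactRegular : ObjectProperty Frm.{u} :=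
  fun F => IsCompactFrame F ∧ IsRegularFrame F

/-- The category of compact regular frames and frame homomorphisms. -/
abbrev KRFrm : Type (u + 1) := isCompactRegular.{u}.FullSubcategory

section WellInside

variable {F : Type u} [Order.Frame F]

theorem WellInside.mono {a a' b b' : F} (h : WellInside a b) (ha : a' ≤ a) (hb : b ≤ b') :
    WellInside a' b' := by
  obtain ⟨c, h1, h2⟩ := h
  exact ⟨c, le_bot_iff.1 ((inf_le_inf_left c ha).trans h1.le),
    top_le_iff.1 (h2.ge.trans (sup_le_sup_left hb c))⟩

theorem WellInside.le {a b : F} (h : WellInside a b) : a ≤ b := by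
  obtain ⟨c, h1, h2⟩ := h
  calc a = (c ⊔ b) ⊓ a := by rw [h2, top_inf_eq]
    _ = b ⊓ a := by rw [inf_sup_right, h1, bot_sup_eq]
    _ ≤ b := inf_le_left

theorem WellInside.inf {a b a' b' : F} (h : WellInside a b) (h' : WellInside a' b') :
    WellInside (a ⊓ a') (b ⊓ b') := by
  obtain ⟨c, h1, h2⟩ := h
  obtain ⟨c', h1', h2'⟩ := h'
  refine ⟨c ⊔ c', ?_, ?_⟩
  · rw [inf_sup_right, ← inf_assoc, h1, bot_inf_eq, bot_sup_eq, inf_comm a a', ← inf_assoc, h1',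
      bot_inf_eq]
  · rw [sup_inf_left, sup_right_comm, h2, top_sup_eq, top_inf_eq, sup_assoc, h2', sup_top_eq]

theorem WellInside.sup {a b a' b' : F} (h : WellInside a b) (h' : WellInside a' b') :
    WellInside (a ⊔ a') (b ⊔ b') := by
  obtain ⟨c, h1, h2⟩ := h
  obtain ⟨c', h1', h2'⟩ := h'
  refine ⟨c ⊓ c', ?_, ?_⟩
  · rw [inf_sup_left, inf_right_comm, h1, bot_inf_eq, bot_sup_eq, inf_assoc, h1', inf_bot_eq]
  · rw [sup_inf_right, ← sup_assoc, h2, top_sup_eq, top_inf_eq, sup_left_comm, h2', sup_top_eq]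

theorem wellInside_bot (b : F) : WellInside ⊥ b := ⟨⊤, by simp, by simp⟩

theorem directedOn_wellInside (b : F) : DirectedOn (· ≤ ·) {a : F | WellInside a b} := by
  intro a ha a' ha'
  refine ⟨a ⊔ a', ?_, le_sup_left, le_sup_right⟩
  have := WellInside.sup ha ha'
  rwa [sup_idem] at this

theorem IsCompactFrame.exists_sup_eq_top (hF : IsCompactFrame F) {A : Set F} (hA : A.Nonempty)
    (hd : DirectedOn (· ≤ ·) A) {c : F} (h : c ⊔ sSup A = ⊤) : ∃ a ∈ A, c ⊔ a = ⊤ := by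
  have h1 : sSup ((fun a => c ⊔ a) '' A) = ⊤ := by
    rw [sSup_image, ← h]
    apply le_antisymm
    · exact iSup₂_le fun a ha => sup_le_sup_left (le_sSup ha) c
    · obtain ⟨a, ha⟩ := hA
      refine sup_le (le_sup_left.trans (le_iSup₂ (f := fun a (_ : a ∈ A) => c ⊔ a) a ha)) ?_
      exact sSup_le fun a ha =>
        le_sup_right.trans (le_iSup₂ (f := fun a (_ : a ∈ A) => c ⊔ a) a ha)
  obtain ⟨T, hTS, hT, hTtop⟩ := hF _ h1
  have h2 : ∀ T : Set F, T.Finite → T ⊆ (fun a => c ⊔ a) '' A → ∃ a ∈ A, ∀ t ∈ T, t ≤ c ⊔ a := by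
    intro T hT
    induction T, hT using Set.Finite.induction_on with
    | empty =>
      intro _
      obtain ⟨a, ha⟩ := hA
      exact ⟨a, ha, by simp⟩
    | insert _ _ ih =>
      intro hs
      obtain ⟨a, ha, hle⟩ := ih ((Set.subset_insert _ _).trans hs)
      obtain ⟨a', ha', rfl⟩ := hs (Set.mem_insert _ _)
      obtain ⟨b, hb, hab, hab'⟩ := hd a ha a' ha'
      refine ⟨b, hb, ?_⟩
      rintro t (rfl | ht)
      · exact sup_le_sup_left hab' c
      · exact (hle t ht).trans (sup_le_sup_left hab c)
  obtain ⟨a, ha, hle⟩ := h2 T hT hTS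
  exact ⟨a, ha, top_le_iff.1 (hTtop.ge.trans (sSup_le hle))⟩

theorem IsCompactFrame.exists_wellInside (hF : IsCompactFrame F) {A : Set F} (hA : A.Nonempty)
    (hd : DirectedOn (· ≤ ·) A) {b : F} (h : WellInside b (sSup A)) : ∃ a ∈ A, WellInside b a := by
  obtain ⟨c, h1, h2⟩ := h
  obtain ⟨a, ha, h3⟩ := hF.exists_sup_eq_top hA hd h2
  exact ⟨a, ha, c, h1, h3⟩

theorem IsCompactFrame.exists_wellInside_sup (hF : IsCompactFrame F) (hR : IsRegularFrame F)
    {a b : F} (h : a ⊔ b = ⊤) : ∃ a', WellInside a' a ∧ a' ⊔ b = ⊤ := by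
  rw [sup_comm, hR a] at h
  obtain ⟨a', ha', h'⟩ := hF.exists_sup_eq_top ⟨⊥, wellInside_bot a⟩ (directedOn_wellInside a) h
  exact ⟨a', ha', by rw [sup_comm]; exact h'⟩

end WellInside

/-! ### The monotone neighbourhood functor on frames -/

/-- The generators `□ a` and `◇ a`, for `a` in `F`, of the monotone neighbourhood frame. -/
inductive MonGen (F : Type u) : Type u
  | box (a : F) : MonGen F
  | dia (a : F) : MonGen F

/-- The assignment of the generators given by `□ a ↦ b a` and `◇ a ↦ d a`. -/
def MonGen.elim {F : Type u} {L : Type v} (b d : F → L) : MonGen F → L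
  | MonGen.box a => b a
  | MonGen.dia a => d a

/-- The generator `□ a` in the free frame. -/
def freeBox {F : Type u} (a : F) : FreeFrame (MonGen F) := FreeFrame.gen (MonGen.box a)

/-- The generator `◇ a` in the free frame. -/
def freeDia {F : Type u} (a : F) : FreeFrame (MonGen F) := FreeFrame.gen (MonGen.dia a)

/-- The relations `l ≤ r` of the monotone neighbourhood frame; an equation is given by its two
inequalities. Directed sets are non-empty, as usual. -/
inductive MonRel (F : Type u) [Order.Frame F] :
    FreeFrame (MonGen F) → FreeFrame (MonGen F) → Prop
  | box_inf (a b : F) : MonRel F (freeBox (a ⊓ b)) (freeBox a)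
  | box_inf_dia (a b : F) (h : a ⊓ b = ⊥) : MonRel F (freeBox a ⊓ freeDia b) ⊥
  | box_sSup_le (A : Set F) (hA : A.Nonempty) (hd : DirectedOn (· ≤ ·) A) :
      MonRel F (freeBox (sSup A)) (⨆ a ∈ A, freeBox a)
  | le_box_sSup (A : Set F) (hA : A.Nonempty) (hd : DirectedOn (· ≤ ·) A) :
      MonRel F (⨆ a ∈ A, freeBox a) (freeBox (sSup A))
  | dia_sup (a b : F) : MonRel F (freeDia a) (freeDia (a ⊔ b))
  | box_sup_dia (a b : F) (h : a ⊔ b = ⊤) : MonRel F ⊤ (freeBox a ⊔ freeDia b)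
  | dia_sSup_le (A : Set F) (hA : A.Nonempty) (hd : DirectedOn (· ≤ ·) A) :
      MonRel F (freeDia (sSup A)) (⨆ a ∈ A, freeDia a)
  | le_dia_sSup (A : Set F) (hA : A.Nonempty) (hd : DirectedOn (· ≤ ·) A) :
      MonRel F (⨆ a ∈ A, freeDia a) (freeDia (sSup A))

/-- The monotone neighbourhood frame of a frame. -/
abbrev MonFrame (F : Type u) [Order.Frame F] : Type u := PresentedFrame (MonRel F)

namespace MonFrame

section

variable {F : Type u} [Order.Frame F]

/-- The generator `□ a` of the monotone neighbourhood frame. -/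
def box (a : F) : MonFrame F := PresentedFrame.gen (MonRel F) (MonGen.box a)

/-- The generator `◇ a` of the monotone neighbourhood frame. -/
def dia (a : F) : MonFrame F := PresentedFrame.gen (MonRel F) (MonGen.dia a)

theorem mk_freeBox (a : F) : PresentedFrame.mk (MonRel F) (freeBox a) = box a := rfl

theorem mk_freeDia (a : F) : PresentedFrame.mk (MonRel F) (freeDia a) = dia a := rfl

theorem box_mono {a b : F} (h : a ≤ b) : box a ≤ box b := by
  have := PresentedFrame.mk_le_mk (MonRel.box_inf b a)
  rwa [mk_freeBox, mk_freeBox, inf_eq_right.2 h] at this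

theorem dia_mono {a b : F} (h : a ≤ b) : dia a ≤ dia b := by
  have := PresentedFrame.mk_le_mk (MonRel.dia_sup a b)
  rwa [mk_freeDia, mk_freeDia, sup_eq_right.2 h] at this

theorem box_inf_dia {a b : F} (h : a ⊓ b = ⊥) : box a ⊓ dia b = ⊥ := by
  have := PresentedFrame.mk_le_mk (MonRel.box_inf_dia a b h)
  rwa [map_inf, map_bot, mk_freeBox, mk_freeDia, le_bot_iff] at this

theorem box_sup_dia {a b : F} (h : a ⊔ b = ⊤) : box a ⊔ dia b = ⊤ := by
  have := PresentedFrame.mk_le_mk (MonRel.box_sup_dia a b h)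
  rwa [map_sup, map_top, mk_freeBox, mk_freeDia, top_le_iff] at this

theorem box_sSup {A : Set F} (hA : A.Nonempty) (hd : DirectedOn (· ≤ ·) A) :
    box (sSup A) = ⨆ a ∈ A, box a := by
  have h1 := PresentedFrame.mk_le_mk (MonRel.box_sSup_le A hA hd)
  have h2 := PresentedFrame.mk_le_mk (MonRel.le_box_sSup A hA hd)
  simp only [map_iSup, mk_freeBox] at h1 h2
  exact le_antisymm h1 h2

theorem dia_sSup {A : Set F} (hA : A.Nonempty) (hd : DirectedOn (· ≤ ·) A) :
    dia (sSup A) = ⨆ a ∈ A, dia a := by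
  have h1 := PresentedFrame.mk_le_mk (MonRel.dia_sSup_le A hA hd)
  have h2 := PresentedFrame.mk_le_mk (MonRel.le_dia_sSup A hA hd)
  simp only [map_iSup, mk_freeDia] at h1 h2
  exact le_antisymm h1 h2

/-- An assignment of the generators that satisfies the relations. -/
structure Model {L : Type v} [Order.Frame L] (b d : F → L) : Prop where
  box_mono : ∀ x y, b (x ⊓ y) ≤ b x
  box_inf_dia : ∀ x y, x ⊓ y = ⊥ → b x ⊓ d y = ⊥
  box_sSup : ∀ A : Set F, A.Nonempty → DirectedOn (· ≤ ·) A → b (sSup A) = ⨆ a ∈ A, b a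
  dia_mono : ∀ x y, d x ≤ d (x ⊔ y)
  box_sup_dia : ∀ x y, x ⊔ y = ⊤ → b x ⊔ d y = ⊤
  dia_sSup : ∀ A : Set F, A.Nonempty → DirectedOn (· ≤ ·) A → d (sSup A) = ⨆ a ∈ A, d a

/-- The homomorphism out of the monotone neighbourhood frame given by an assignment of the
generators. -/
def lift {L : Type v} [Order.Frame L] (b d : F → L) (h : Model b d) : FrameHom (MonFrame F) L :=
  PresentedFrame.lift (MonGen.elim b d) (by
    have hb : ∀ a, FreeFrame.lift (MonGen.elim b d) (freeBox a) = b a :=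
      fun a => FreeFrame.lift_gen _ _
    have hd : ∀ a, FreeFrame.lift (MonGen.elim b d) (freeDia a) = d a :=
      fun a => FreeFrame.lift_gen _ _
    intro l r hR
    induction hR with
    | box_inf x y => rw [hb, hb]; exact h.box_mono x y
    | box_inf_dia x y hxy => rw [map_inf, hb, hd, map_bot]; exact (h.box_inf_dia x y hxy).le
    | box_sSup_le A hA hdir => simp only [map_iSup, hb]; exact (h.box_sSup A hA hdir).le
    | le_box_sSup A hA hdir => simp only [map_iSup, hb]; exact (h.box_sSup A hA hdir).ge
    | dia_sup x y => rw [hd, hd]; exact h.dia_mono x y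
    | box_sup_dia x y hxy => rw [map_sup, hb, hd, map_top]; exact (h.box_sup_dia x y hxy).ge
    | dia_sSup_le A hA hdir => simp only [map_iSup, hd]; exact (h.dia_sSup A hA hdir).le
    | le_dia_sSup A hA hdir => simp only [map_iSup, hd]; exact (h.dia_sSup A hA hdir).ge)

@[simp]
theorem lift_box {L : Type v} [Order.Frame L] (b d : F → L) (h : Model b d) (a : F) :
    lift b d h (box a) = b a := PresentedFrame.lift_gen _ _ _

@[simp]
theorem lift_dia {L : Type v} [Order.Frame L] (b d : F → L) (h : Model b d) (a : F) :
    lift b d h (dia a) = d a := PresentedFrame.lift_gen _ _ _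

theorem hom_ext {L : Type v} [Order.Frame L] {p q : FrameHom (MonFrame F) L}
    (hb : ∀ a, p (box a) = q (box a)) (hd : ∀ a, p (dia a) = q (dia a)) : p = q := by
  apply PresentedFrame.hom_ext
  rintro (a | a)
  · exact hb a
  · exact hd a

end

theorem model_comp {F F' : Type u} [Order.Frame F] [Order.Frame F'] (f : FrameHom F F') :
    Model (fun a => box (f a)) (fun a => dia (f a)) where
  box_mono x y := box_mono (OrderHomClass.mono f inf_le_left)
  box_inf_dia x y h := box_inf_dia (by rw [← map_inf, h, map_bot])
  box_sSup A hA hd := by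
    rw [map_sSup, box_sSup (hA.image f) (hd.mono_comp fun _ _ h => OrderHomClass.mono f h),
      iSup_image]
  dia_mono x y := dia_mono (OrderHomClass.mono f le_sup_left)
  box_sup_dia x y h := box_sup_dia (by rw [← map_sup, h, map_top])
  dia_sSup A hA hd := by
    rw [map_sSup, dia_sSup (hA.image f) (hd.mono_comp fun _ _ h => OrderHomClass.mono f h),
      iSup_image]

/-- The action on homomorphisms: `□ a ↦ □ f(a)` and `◇ a ↦ ◇ f(a)`. -/
def map {F F' : Type u} [Order.Frame F] [Order.Frame F'] (f : FrameHom F F') :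
    FrameHom (MonFrame F) (MonFrame F') :=
  lift (fun a => box (f a)) (fun a => dia (f a)) (model_comp f)

end MonFrame

/-- The monotone neighbourhood functor `M` on frames. -/
noncomputable def monFunctor : Frm.{u} ⥤ Frm.{u} where
  obj F := Frm.of (MonFrame F)
  map f := Frm.ofHom (MonFrame.map f.hom)
  map_id F := Frm.hom_ext (MonFrame.hom_ext
    (fun a => MonFrame.lift_box _ _ (MonFrame.model_comp (FrameHom.id F)) a)
    (fun a => MonFrame.lift_dia _ _ (MonFrame.model_comp (FrameHom.id F)) a))
  map_comp f g := Frm.hom_ext (MonFrame.hom_ext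
    (fun a => by simp [MonFrame.map]) (fun a => by simp [MonFrame.map]))

namespace MonFrame

variable {F : Type u} [Order.Frame F]

theorem wellInside_box {a b : F} (h : WellInside a b) : WellInside (box a) (box b) := by
  obtain ⟨c, h1, h2⟩ := h
  refine ⟨dia c, ?_, ?_⟩
  · rw [inf_comm]; exact box_inf_dia (by rw [inf_comm]; exact h1)
  · rw [sup_comm]; exact box_sup_dia (by rw [sup_comm]; exact h2)

theorem wellInside_dia {a b : F} (h : WellInside a b) : WellInside (dia a) (dia b) := by
  obtain ⟨c, h1, h2⟩ := h
  exact ⟨box c, box_inf_dia h1, box_sup_dia h2⟩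

/-- `M` preserves regularity. -/
theorem isRegularFrame (hR : IsRegularFrame F) : IsRegularFrame (MonFrame F) := by
  have hbox : ∀ a : F, box a ≤ sSup {y : MonFrame F | WellInside y (box a)} := by
    intro a
    conv_lhs => rw [hR a, box_sSup ⟨⊥, wellInside_bot a⟩ (directedOn_wellInside a)]
    exact iSup₂_le fun b hb => le_sSup (wellInside_box hb)
  have hdia : ∀ a : F, dia a ≤ sSup {y : MonFrame F | WellInside y (dia a)} := by
    intro a
    conv_lhs => rw [hR a, dia_sSup ⟨⊥, wellInside_bot a⟩ (directedOn_wellInside a)]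
    exact iSup₂_le fun b hb => le_sSup (wellInside_dia hb)
  have hgen : ∀ g : MonGen F, PresentedFrame.gen (MonRel F) g ≤
      sSup {y : MonFrame F | WellInside y (PresentedFrame.gen (MonRel F) g)} := by
    rintro (a | a)
    · exact hbox a
    · exact hdia a
  have hfin : ∀ s : Finset (MonGen F), s.inf (PresentedFrame.gen (MonRel F)) ≤
      sSup {y : MonFrame F | WellInside y (s.inf (PresentedFrame.gen (MonRel F)))} := by
    classical
    intro s
    induction s using Finset.induction_on with
    | empty => exact le_sSup ⟨⊥, by simp, by simp⟩
    | insert g s _ ih =>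
      rw [Finset.inf_insert]
      refine (inf_le_inf (hgen g) ih).trans ?_
      rw [sSup_inf_sSup]
      refine iSup₂_le fun p hp => le_sSup ?_
      exact WellInside.inf hp.1 hp.2
  intro x
  apply le_antisymm
  · conv_lhs => rw [PresentedFrame.eq_iSup x]
    refine iSup₂_le fun s hs => (hfin (OrderDual.ofDual s)).trans (sSup_le fun y hy => le_sSup ?_)
    refine WellInside.mono hy le_rfl ?_
    conv_rhs => rw [PresentedFrame.eq_iSup x]
    exact le_iSup₂ (f := fun s (_ : s ∈ x.1) =>
      (OrderDual.ofDual s).inf (PresentedFrame.gen (MonRel F))) s hs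
  · exact sSup_le fun y hy => WellInside.le hy

theorem model_of_prime (hF : IsCompactFrame F) (hR : IsRegularFrame F)
    (P : Order.Ideal (MonFrame F)) (hP : P.IsPrime) :
    Model (L := Prop) (fun a : F => ∃ b, WellInside b a ∧ box b ∉ P)
      (fun a : F => ∃ b, WellInside b a ∧ dia b ∉ P) where
  box_mono x y := by
    rintro ⟨b, hb, h⟩
    exact ⟨b, hb.mono le_rfl inf_le_left, h⟩
  dia_mono x y := by
    rintro ⟨b, hb, h⟩
    exact ⟨b, hb.mono le_rfl le_sup_left, h⟩
  box_inf_dia x y h := by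
    rw [← le_bot_iff]
    rintro ⟨⟨b, hb, hbP⟩, ⟨c, hc, hcP⟩⟩
    have h0 : box b ⊓ dia c = ⊥ :=
      box_inf_dia (le_bot_iff.1 ((inf_le_inf hb.le hc.le).trans h.le))
    rcases hP.mem_or_mem (x := box b) (y := dia c) (h0 ▸ P.bot_mem) with h1 | h1
    · exact hbP h1
    · exact hcP h1
  box_sup_dia x y h := by
    obtain ⟨x', hx, h1⟩ := hF.exists_wellInside_sup hR h
    rw [sup_comm] at h1
    obtain ⟨y', hy, h2⟩ := hF.exists_wellInside_sup hR h1
    rw [sup_comm] at h2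
    have h0 := box_sup_dia h2
    rw [← top_le_iff]
    intro _
    by_cases hxP : box x' ∈ P
    · right
      refine ⟨y', hy, fun hyP => ?_⟩
      have := Order.Ideal.sup_mem hxP hyP
      rw [h0] at this
      exact hP.toIsProper.top_notMem this
    · left
      exact ⟨x', hx, hxP⟩
  box_sSup A hA hd := by
    apply propext
    simp only [iSup_Prop_eq]
    constructor
    · rintro ⟨b, hb, h⟩
      obtain ⟨a, ha, hba⟩ := hF.exists_wellInside hA hd hb
      exact ⟨a, ha, b, hba, h⟩
    · rintro ⟨a, ha, b, hb, h⟩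
      exact ⟨b, hb.mono le_rfl (le_sSup ha), h⟩
  dia_sSup A hA hd := by
    apply propext
    simp only [iSup_Prop_eq]
    constructor
    · rintro ⟨b, hb, h⟩
      obtain ⟨a, ha, hba⟩ := hF.exists_wellInside hA hd hb
      exact ⟨a, ha, b, hba, h⟩
    · rintro ⟨a, ha, b, hb, h⟩
      exact ⟨b, hb.mono le_rfl (le_sSup ha), h⟩

/-- `M` sends compact regular frames to compact frames. -/
theorem isCompactFrame (hF : IsCompactFrame F) (hR : IsRegularFrame F) :
    IsCompactFrame (MonFrame F) := by
  intro S hS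
  by_contra hcon
  push Not at hcon
  let I : Order.Ideal (MonFrame F) :=
    { carrier := {x | ∃ T : Set (MonFrame F), T ⊆ S ∧ T.Finite ∧ x ≤ sSup T}
      lower' := fun x y hyx ⟨T, h1, h2, h3⟩ => ⟨T, h1, h2, hyx.trans h3⟩
      nonempty' := ⟨⊥, ∅, by simp, Set.finite_empty, bot_le⟩
      directed' := by
        rintro x ⟨T, h1, h2, h3⟩ y ⟨T', h1', h2', h3'⟩
        refine ⟨x ⊔ y, ⟨T ∪ T', Set.union_subset h1 h1', h2.union h2', ?_⟩, le_sup_left,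
          le_sup_right⟩
        rw [sSup_union]
        exact sup_le_sup h3 h3' }
  have hdisj : Disjoint (Order.PFilter.principal (⊤ : MonFrame F) : Set (MonFrame F))
      (I : Set (MonFrame F)) := by
    rw [Set.disjoint_left]
    rintro x hx ⟨T, h1, h2, h3⟩
    have hx' : ⊤ ≤ x := hx
    exact hcon T h1 h2 (top_le_iff.1 (hx'.trans h3))
  obtain ⟨P, hP, hIP, -⟩ := DistribLattice.prime_ideal_of_disjoint_filter_ideal hdisj
  let p : FrameHom (MonFrame F) Prop := lift _ _ (model_of_prime hF hR P hP)
  have hgen : ∀ g : MonGen F, p (PresentedFrame.gen (MonRel F) g) →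
      PresentedFrame.gen (MonRel F) g ∉ P := by
    rintro (a | a) hpa
    · have hpa' : p (box a) := hpa
      rw [lift_box] at hpa'
      obtain ⟨b, hb, hbP⟩ := hpa'
      exact fun h => hbP (P.lower (box_mono hb.le) h)
    · have hpa' : p (dia a) := hpa
      rw [lift_dia] at hpa'
      obtain ⟨b, hb, hbP⟩ := hpa'
      exact fun h => hbP (P.lower (dia_mono hb.le) h)
  have hfin : ∀ s : Finset (MonGen F), p (s.inf (PresentedFrame.gen (MonRel F))) →
      s.inf (PresentedFrame.gen (MonRel F)) ∉ P := by
    classical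
    intro s
    induction s using Finset.induction_on with
    | empty => exact fun _ => hP.toIsProper.top_notMem
    | insert g s _ ih =>
      rw [Finset.inf_insert, map_inf]
      rintro ⟨h1, h2⟩ h3
      rcases hP.mem_or_mem h3 with h | h
      · exact hgen g h1 h
      · exact ih h2 h
  have hall : ∀ x : MonFrame F, p x → x ∉ P := by
    intro x hx hxP
    rw [PresentedFrame.eq_iSup x] at hx
    simp only [map_iSup, iSup_Prop_eq] at hx
    obtain ⟨s, hs, hps⟩ := hx
    refine hfin _ hps (P.lower ?_ hxP)
    conv_rhs => rw [PresentedFrame.eq_iSup x]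
    exact le_iSup₂ (f := fun s (_ : s ∈ x.1) =>
      (OrderDual.ofDual s).inf (PresentedFrame.gen (MonRel F))) s hs
  have htop : p (sSup S) := by
    rw [hS, map_top]
    trivial
  rw [map_sSup, sSup_image] at htop
  simp only [iSup_Prop_eq] at htop
  obtain ⟨x, hx, hpx⟩ := htop
  exact hall x hpx (hIP ⟨{x}, by simpa using hx, Set.finite_singleton x, by simp⟩)

end MonFrame

/-- The restriction of `M` to compact regular frames. -/
noncomputable def monKR : KRFrm.{u} ⥤ KRFrm.{u} :=
  isCompactRegular.lift (isCompactRegular.ι ⋙ monFunctor) fun F =>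
    show IsCompactFrame (MonFrame F.obj) ∧ IsRegularFrame (MonFrame F.obj) from
      ⟨MonFrame.isCompactFrame F.property.1 F.property.2, MonFrame.isRegularFrame F.property.2⟩

/-! ### The frame of opens of a compact Hausdorff space -/

theorem isCompactRegular_opens (X : Type u) [TopologicalSpace X] [CompactSpace X] [T2Space X] :
    IsCompactFrame (Opens X) ∧ IsRegularFrame (Opens X) := by
  constructor
  · intro S hS
    have hc : (Set.univ : Set X) ⊆ ⋃ a : S, (a.1 : Set X) := by
      intro x _
      have hx : x ∈ sSup S := by rw [hS]; trivial
      obtain ⟨a, ha, hxa⟩ := Opens.mem_sSup.1 hx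
      exact Set.mem_iUnion.2 ⟨⟨a, ha⟩, hxa⟩
    obtain ⟨t, ht⟩ := isCompact_univ.elim_finite_subcover (fun a : S => (a.1 : Set X))
      (fun a => a.1.isOpen) hc
    refine ⟨Subtype.val '' (t : Set S), ?_, t.finite_toSet.image _, ?_⟩
    · rintro _ ⟨a, _, rfl⟩
      exact a.2
    · rw [eq_top_iff]
      intro x _
      obtain ⟨a, ha, hxa⟩ := Set.mem_iUnion₂.1 (ht (Set.mem_univ x))
      exact Opens.mem_sSup.2 ⟨a.1, ⟨a, ha, rfl⟩, hxa⟩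
  · intro a
    apply le_antisymm
    · intro x hx
      obtain ⟨C, ⟨hC, hCc⟩, hCa⟩ := (closed_nhds_basis x).mem_iff.1 (a.isOpen.mem_nhds hx)
      refine Opens.mem_sSup.2 ⟨⟨interior C, isOpen_interior⟩, ?_, mem_interior_iff_mem_nhds.2 hC⟩
      refine ⟨⟨Cᶜ, hCc.isOpen_compl⟩, ?_, ?_⟩
      · ext y
        simp only [Opens.coe_inf, Opens.coe_mk, Opens.coe_bot, Set.mem_inter_iff,
          Set.mem_empty_iff_false, iff_false, not_and]
        exact fun h1 h2 => h1 (interior_subset h2)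
      · rw [eq_top_iff]
        intro y _
        by_cases hy : y ∈ C
        · exact Or.inr (hCa hy)
        · exact Or.inl hy
    · exact sSup_le fun b hb => WellInside.le hb

/-- The functor `opn` from compact Hausdorff spaces to compact regular frames, sending a space to
its frame of open sets and a continuous map to its inverse image map. -/
def opnKH : CompHaus.{u}ᵒᵖ ⥤ KRFrm.{u} :=
  isCompactRegular.lift (compHausToTop.op ⋙ topCatOpToFrm) fun X =>
    isCompactRegular_opens X.unop

/-! ### The monotone neighbourhood functor on compact Hausdorff spaces -/

/-- The condition on a collection `W` of subsets of a space `X` of being an element of the monotone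
neighbourhood space: `u ∈ W` iff there is a closed `c ⊆ u` all of whose open supersets are
in `W`. -/
def IsMonNhd {X : Type u} [TopologicalSpace X] (W : Set (Set X)) : Prop :=
  ∀ u : Set X, u ∈ W ↔ ∃ c : Set X, IsClosed c ∧ c ⊆ u ∧ ∀ a : Set X, IsOpen a → c ⊆ a → a ∈ W

/-- The points of the monotone neighbourhood space of `X`. -/
def MonNhd (X : Type u) [TopologicalSpace X] : Type u := {W : Set (Set X) // IsMonNhd W}

namespace MonNhd

section

variable {X : Type u} [TopologicalSpace X]

/-- The subbasic set of all `W` with `a ∈ W`. -/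
def box (a : Set X) : Set (MonNhd X) := {W | a ∈ W.1}

/-- The subbasic set of all `W` with `X \ a ∉ W`. -/
def dia (a : Set X) : Set (MonNhd X) := {W | aᶜ ∉ W.1}

/-- The topology generated by the sets `box a` and `dia a` for open `a`. -/
instance : TopologicalSpace (MonNhd X) :=
  TopologicalSpace.generateFrom
    ({s | ∃ a : Set X, IsOpen a ∧ s = box a} ∪ {s | ∃ a : Set X, IsOpen a ∧ s = dia a})

theorem isOpen_box {a : Set X} (ha : IsOpen a) : IsOpen (box a) :=
  TopologicalSpace.isOpen_generateFrom_of_mem (Or.inl ⟨a, ha, rfl⟩)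

theorem isOpen_dia {a : Set X} (ha : IsOpen a) : IsOpen (dia a) :=
  TopologicalSpace.isOpen_generateFrom_of_mem (Or.inr ⟨a, ha, rfl⟩)

/-- The subbasic open set `box a`, for open `a`, as an element of the frame of opens. -/
def openBox (a : Opens X) : Opens (MonNhd X) := ⟨box a, isOpen_box a.isOpen⟩

/-- The subbasic open set `dia a`, for open `a`, as an element of the frame of opens. -/
def openDia (a : Opens X) : Opens (MonNhd X) := ⟨dia a, isOpen_dia a.isOpen⟩

theorem mem_mono (W : MonNhd X) {u v : Set X} (hu : u ∈ W.1) (huv : u ⊆ v) : v ∈ W.1 := by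
  obtain ⟨c, hc, hcu, h⟩ := (W.2 u).1 hu
  exact (W.2 v).2 ⟨c, hc, hcu.trans huv, h⟩

theorem exists_closed (W : MonNhd X) {u : Set X} (hu : u ∈ W.1) :
    ∃ c ∈ W.1, IsClosed c ∧ c ⊆ u := by
  obtain ⟨c, hc, hcu, h⟩ := (W.2 u).1 hu
  exact ⟨c, (W.2 c).2 ⟨c, hc, subset_rfl, h⟩, hc, hcu⟩

theorem closed_mem (W : MonNhd X) {c : Set X} (hc : IsClosed c)
    (h : ∀ a : Set X, IsOpen a → c ⊆ a → a ∈ W.1) : c ∈ W.1 :=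
  (W.2 c).2 ⟨c, hc, subset_rfl, h⟩

theorem ext_closed {V W : MonNhd X} (h : ∀ c : Set X, IsClosed c → (c ∈ V.1 ↔ c ∈ W.1)) :
    V = W := by
  apply Subtype.ext
  ext u
  constructor
  · intro hu
    obtain ⟨c, hcV, hc, hcu⟩ := V.exists_closed hu
    exact W.mem_mono ((h c hc).1 hcV) hcu
  · intro hu
    obtain ⟨c, hcV, hc, hcu⟩ := W.exists_closed hu
    exact V.mem_mono ((h c hc).2 hcV) hcu

theorem exists_disjoint [CompactSpace X] [T2Space X] {V W : MonNhd X} {c : Set X} (hc : IsClosed c)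
    (hV : c ∈ V.1) (hW : c ∉ W.1) :
    ∃ s t : Set (MonNhd X), IsOpen s ∧ IsOpen t ∧ V ∈ s ∧ W ∈ t ∧ Disjoint s t := by
  have h : ∃ a : Set X, IsOpen a ∧ c ⊆ a ∧ a ∉ W.1 := by
    by_contra hcon
    push Not at hcon
    exact hW (W.closed_mem hc hcon)
  obtain ⟨a, ha, hca, haW⟩ := h
  obtain ⟨b, hb, hcb, hba⟩ := normal_exists_closure_subset hc ha hca
  refine ⟨box b, dia (closure b)ᶜ, isOpen_box hb, isOpen_dia isClosed_closure.isOpen_compl,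
    V.mem_mono hV hcb, ?_, ?_⟩
  · change (closure b)ᶜᶜ ∉ W.1
    rw [compl_compl]
    exact fun h => haW (W.mem_mono h hba)
  · rw [Set.disjoint_left]
    intro U h1 h2
    change (closure b)ᶜᶜ ∉ U.1 at h2
    rw [compl_compl] at h2
    exact h2 (U.mem_mono h1 subset_closure)

instance instT2Space [CompactSpace X] [T2Space X] : T2Space (MonNhd X) where
  t2 := by
    intro V W hVW
    have h : ∃ c : Set X, IsClosed c ∧ ¬ (c ∈ V.1 ↔ c ∈ W.1) := by
      by_contra hcon
      push Not at hcon
      exact hVW (ext_closed hcon)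
    obtain ⟨c, hc, hne⟩ := h
    by_cases hV : c ∈ V.1
    · exact exists_disjoint hc hV fun hW => hne (iff_of_true hV hW)
    · have hW : c ∈ W.1 := by
        by_contra hW
        exact hne (iff_of_false hV hW)
      obtain ⟨s, t, hs, ht, h1, h2, hd⟩ := exists_disjoint hc hW hV
      exact ⟨t, s, ht, hs, h2, h1, hd.symm⟩

/-- The limit of an ultrafilter of points of the monotone neighbourhood space. -/
def limit (U : Ultrafilter (MonNhd X)) : MonNhd X :=
  ⟨{u | ∃ c : Set X, IsClosed c ∧ c ⊆ u ∧ ∀ a : Set X, IsOpen a → c ⊆ a →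
    ∀ᶠ V : MonNhd X in (U : Filter (MonNhd X)), a ∈ V.1}, by
    intro u
    constructor
    · rintro ⟨c, hc, hcu, h⟩
      exact ⟨c, hc, hcu, fun a ha hca => ⟨c, hc, hca, h⟩⟩
    · rintro ⟨c, hc, hcu, h⟩
      refine ⟨c, hc, hcu, fun a ha hca => ?_⟩
      obtain ⟨c', hc', hca', h'⟩ := h a ha hca
      exact h' a ha hca'⟩

instance instCompactSpace : CompactSpace (MonNhd X) where
  isCompact_univ := by
    rw [isCompact_iff_ultrafilter_le_nhds]
    intro U _
    refine ⟨limit U, Set.mem_univ _, ?_⟩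
    rw [TopologicalSpace.nhds_generateFrom]
    refine le_iInf₂ fun s hs => ?_
    rw [Filter.le_principal_iff]
    obtain ⟨hmem, ⟨a, ha, rfl⟩ | ⟨a, ha, rfl⟩⟩ := hs
    · have hmem' : a ∈ (limit U).1 := hmem
      obtain ⟨c, hc, hca, h⟩ := hmem'
      exact h a ha hca
    · have h : ∃ b : Set X, IsOpen b ∧ aᶜ ⊆ b ∧
          ¬ ∀ᶠ V : MonNhd X in (U : Filter (MonNhd X)), b ∈ V.1 := by
        by_contra hcon
        push Not at hcon
        exact hmem ⟨aᶜ, ha.isClosed_compl, subset_rfl, hcon⟩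
      obtain ⟨b, hb, hab, h⟩ := h
      rw [← Ultrafilter.eventually_not] at h
      filter_upwards [h] with V hV
      exact fun hVa => hV (V.mem_mono hVa hab)

end

section

variable {X Y : Type u} [TopologicalSpace X] [CompactSpace X] [T2Space X]
  [TopologicalSpace Y] [CompactSpace Y] [T2Space Y]

/-- The action on points of a continuous map: `W ↦ {a ⊆ Y | f⁻¹(a) ∈ W}`. -/
def mapFun (f : C(X, Y)) (W : MonNhd X) : MonNhd Y :=
  ⟨{a | f ⁻¹' a ∈ W.1}, by
    intro u
    constructor
    · intro hu
      obtain ⟨c, hcW, hc, hcu⟩ := W.exists_closed hu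
      refine ⟨f '' c, (hc.isCompact.image f.continuous).isClosed, Set.image_subset_iff.2 hcu, ?_⟩
      intro a _ hca
      exact W.mem_mono hcW (Set.image_subset_iff.1 hca)
    · rintro ⟨c, hc, hcu, h⟩
      refine W.mem_mono (W.closed_mem (hc.preimage f.continuous) ?_) (Set.preimage_mono hcu)
      intro a ha hca
      have hcl : IsClosed (f '' aᶜ) :=
        (ha.isClosed_compl.isCompact.image f.continuous).isClosed
      refine W.mem_mono (h (f '' aᶜ)ᶜ hcl.isOpen_compl ?_) ?_
      · rintro y hy ⟨x, hx, rfl⟩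
        exact hx (hca hy)
      · intro x hx
        by_contra hxa
        exact hx ⟨x, hxa, rfl⟩⟩

/-- The continuous map between monotone neighbourhood spaces induced by a continuous map. -/
def map (f : C(X, Y)) : C(MonNhd X, MonNhd Y) where
  toFun := mapFun f
  continuous_toFun := by
    refine continuous_generateFrom_iff.2 ?_
    rintro _ (⟨a, ha, rfl⟩ | ⟨a, ha, rfl⟩)
    · exact isOpen_box (ha.preimage f.continuous)
    · exact isOpen_dia (ha.preimage f.continuous)

end

end MonNhd

/-- The monotone neighbourhood functor on compact Hausdorff spaces. -/
def monKH : CompHaus.{u} ⥤ CompHaus.{u} where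
  obj X := CompHaus.of (MonNhd X.toTop)
  map {X Y} f := CompHausLike.ofHom _ (MonNhd.map (X := X) (Y := Y) f.hom.hom)

/-! ### From coalgebras to algebras -/

/-- A natural transformation `M ∘ opn ⟶ opn ∘ D` turns a coalgebra `γ : X ⟶ D X` into the algebra
`M (opn X) ⟶ opn (D X) ⟶ opn X`, contravariantly. -/
noncomputable def coalgebraToAlgebra (η : opnKH.{u} ⋙ monKR.{u} ⟶ monKH.{u}.op ⋙ opnKH.{u}) :
    (Endofunctor.Coalgebra monKH.{u})ᵒᵖ ⥤ Endofunctor.Algebra monKR.{u} where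
  obj V := ⟨opnKH.obj (op V.unop.V), η.app (op V.unop.V) ≫ opnKH.map V.unop.str.op⟩
  map {V W} f :=
    { f := opnKH.map f.unop.f.op
      h := by
        have h1 := η.naturality f.unop.f.op
        have h2 := f.unop.h
        dsimp at h1
        rw [← Category.assoc, h1, Category.assoc, Category.assoc, ← Functor.map_comp,
          ← Functor.map_comp]
        congr 2
        exact congrArg Quiver.Hom.op h2 }

/-! ### Points of compact regular frames -/

/-! The proof rests on Isbell duality: `opnKH` is an equivalence. A compact regular frame has enough
points, because a prime ideal `P` becomes a completely prime filter once it is shrunk along the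
well-inside relation: `a` is kept iff some element well inside `a` avoids `P`. Hence the frame is
the topology of its space of points, which is compact Hausdorff.

The comparison `MonNhd.ofMonFrame` exists because the subbasic sets of `MonNhd X` satisfy the
relations of `M`. It is onto since these sets generate the topology. It is injective since `M (opn
X)` is again compact regular, so its points separate its elements, and every such point `p` comes
from a point `MonNhd.ofPoint p` of `MonNhd X`. The collection is rebuilt from `p` by declaring a
closed set large when `p` holds at `□ a` for all open `a` around it; regularity shows that no
information about `□` or `◇` is lost (`MonNhd.mem_box_ofPoint`, `MonNhd.mem_dia_ofPoint`).

The rest is formal: a dual equivalence together with a natural isomorphism intertwining two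
endofunctors lifts to a dual equivalence between coalgebras and algebras. -/

section Points

variable {F : Type u} [Order.Frame F]

/-- The point of a compact regular frame given by a prime ideal `P`: it contains `a` iff some
element well inside `a` is not in `P`. -/
def primePoint (hF : IsCompactFrame F) (hR : IsRegularFrame F) (P : Order.Ideal F)
    (hP : P.IsPrime) : FrameHom F Prop where
  toFun a := ∃ b, WellInside b a ∧ b ∉ P
  map_inf' a b := by
    apply propext
    constructor
    · rintro ⟨c, hc, h⟩
      exact ⟨⟨c, hc.mono le_rfl inf_le_left, h⟩, ⟨c, hc.mono le_rfl inf_le_right, h⟩⟩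
    · rintro ⟨⟨c, hc, h⟩, ⟨d, hd, h'⟩⟩
      refine ⟨c ⊓ d, hc.inf hd, fun hm => ?_⟩
      -- Primeness of `P` is what makes the filter closed under meets.
      rcases hP.mem_or_mem hm with h1 | h1
      · exact h h1
      · exact h' h1
  map_top' := by
    rw [← top_le_iff]
    exact fun _ => ⟨⊤, ⟨⊥, by simp, by simp⟩, hP.toIsProper.top_notMem⟩
  map_sSup' S := by
    apply propext
    rw [sSup_image]
    simp only [iSup_Prop_eq]
    constructor
    · rintro ⟨b, ⟨c, hcb, hc⟩, hbP⟩
      have hA : sSup (⋃ a ∈ S, {d : F | WellInside d a}) = sSup S := by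
        apply le_antisymm
        · refine sSup_le fun d hd => ?_
          obtain ⟨a, ha, hda⟩ := Set.mem_iUnion₂.1 hd
          exact (WellInside.le hda).trans (le_sSup ha)
        · refine sSup_le fun a ha => ?_
          conv_lhs => rw [hR a]
          exact sSup_le_sSup (Set.subset_biUnion_of_mem (u := fun a => {d : F | WellInside d a}) ha)
      -- Compactness is applied to the complementing witness `c` together with everything well
      -- inside a member of `S`. If all those elements were in `P`, then so would be the meet of `b`
      -- with each member of the finite subcover (`b ⊓ c = ⊥`), and hence `b` itself.
      have hcover : sSup (insert c (⋃ a ∈ S, {d : F | WellInside d a})) = ⊤ := by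
        rw [sSup_insert, hA, hc]
      obtain ⟨T, hTS, hT, htop⟩ := hF _ hcover
      by_contra hcon
      push Not at hcon
      have hmem : ∀ t ∈ T, b ⊓ t ∈ P := by
        intro t ht
        rcases hTS ht with rfl | h
        · rw [inf_comm, hcb]
          exact P.bot_mem
        · obtain ⟨a, ha, hta⟩ := Set.mem_iUnion₂.1 h
          exact P.lower inf_le_right (hcon a ha t hta)
      have hfin : ∀ T : Set F, T.Finite → (∀ t ∈ T, b ⊓ t ∈ P) → b ⊓ sSup T ∈ P := by
        intro T hT
        induction T, hT using Set.Finite.induction_on with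
        | empty => simp
        | insert _ _ ih =>
          intro h
          rw [sSup_insert, inf_sup_left]
          exact Order.Ideal.sup_mem (h _ (Set.mem_insert _ _))
            (ih fun t ht => h t (Set.mem_insert_of_mem _ ht))
      have := hfin T hT hmem
      rw [htop, inf_top_eq] at this
      exact hbP this
    · rintro ⟨a, ha, b, hb, h⟩
      exact ⟨b, hb.mono le_rfl (le_sSup ha), h⟩

/-- Compact regular frames are spatial. -/
theorem exists_point_of_not_le (hF : IsCompactFrame F) (hR : IsRegularFrame F) {a b : F}
    (h : ¬ a ≤ b) : ∃ p : FrameHom F Prop, p a ∧ ¬ p b := by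
  -- Regularity supplies room between the filter and `a`: the prime ideal is made to avoid `c`, so
  -- that `c` witnesses that its point contains `a`.
  obtain ⟨c, hca, hcb⟩ : ∃ c, WellInside c a ∧ ¬ c ≤ b := by
    by_contra hcon
    push Not at hcon
    refine h ?_
    rw [hR a]
    exact sSup_le hcon
  have hdisj : Disjoint (Order.PFilter.principal c : Set F)
      (Order.Ideal.principal b : Set F) := by
    rw [Set.disjoint_left]
    intro x hx hx'
    have h1 : c ≤ x := hx
    have h2 : x ≤ b := hx'
    exact hcb (h1.trans h2)
  obtain ⟨P, hP, hbP, hcP⟩ := DistribLattice.prime_ideal_of_disjoint_filter_ideal hdisj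
  refine ⟨primePoint hF hR P hP, ⟨c, hca, fun h' => ?_⟩, ?_⟩
  · exact Set.disjoint_left.1 hcP (show c ≤ c from le_rfl) h'
  -- Anything well inside `b` lies below `b`, hence in `P`.
  · rintro ⟨d, hd, hdP⟩
    exact hdP (P.lower hd.le (hbP (show b ≤ b from le_rfl)))

theorem le_of_forall_point (hF : IsCompactFrame F) (hR : IsRegularFrame F) {a b : F}
    (h : ∀ p : FrameHom F Prop, p a → p b) : a ≤ b := by
  by_contra hab
  obtain ⟨p, hpa, hpb⟩ := exists_point_of_not_le hF hR hab
  exact hpb (h p hpa)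

/-- Injectivity is spatiality; surjectivity is immediate, since the opens of the space of points are
by definition the sets of points containing a fixed element. -/
theorem bijective_counitAppCont (hF : IsCompactFrame F) (hR : IsRegularFrame F) :
    Function.Bijective (Locale.counitAppCont (op (Frm.of F))) := by
  constructor
  · intro a b hab
    have h : ∀ p : FrameHom F Prop, p a ↔ p b := fun p =>
      Set.ext_iff.1 (congrArg (fun U : Opens (Locale.PT F) => (U : Set (Locale.PT F))) hab) p
    exact le_antisymm (le_of_forall_point hF hR fun p => (h p).1)
      (le_of_forall_point hF hR fun p => (h p).2)
  · rintro ⟨U, u, rfl⟩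
    exact ⟨u, rfl⟩

/-- An order isomorphism from a bijective frame homomorphism. -/
noncomputable def FrameHom.orderIsoOfBijective {A : Type u} {B : Type v} [Order.Frame A]
    [Order.Frame B] (f : FrameHom A B) (hf : Function.Bijective f) : A ≃o B where
  toEquiv := Equiv.ofBijective f hf
  map_rel_iff' {a b} := by
    change f a ≤ f b ↔ a ≤ b
    -- The order is recovered from meets, so an injective homomorphism reflects it.
    rw [← inf_eq_left, ← map_inf, hf.1.eq_iff, inf_eq_left]

/-- If `p` contains `a` and `q` does not, regularity gives `b` well inside `a` with `p b`. The
witness `c` is disjoint from `b` and covers ⊤ with `a`, so `q` must contain `c`; thus `b` and `c`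
separate the two points. -/
theorem t2Space_points (hR : IsRegularFrame F) : T2Space (Locale.PT F) where
  t2 := by
    have key : ∀ p q : Locale.PT F, ∀ a, p a → ¬ q a →
        ∃ s t : Set (Locale.PT F), IsOpen s ∧ IsOpen t ∧ p ∈ s ∧ q ∈ t ∧ Disjoint s t := by
      intro p q a hp hq
      rw [hR a, map_sSup, sSup_image] at hp
      simp only [iSup_Prop_eq] at hp
      obtain ⟨b, ⟨c, h1, h2⟩, hpb⟩ := hp
      refine ⟨{x | x b}, {x | x c}, ⟨b, rfl⟩, ⟨c, rfl⟩, hpb, ?_, ?_⟩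
      · have h3 : q (c ⊔ a) := by
          rw [h2, map_top]
          trivial
        rw [map_sup] at h3
        exact h3.resolve_right hq
      · rw [Set.disjoint_left]
        intro x hb hc
        have h3 : x (c ⊓ b) := by
          rw [map_inf]
          exact ⟨hc, hb⟩
        rw [h1, map_bot] at h3
        exact h3
    intro p q hpq
    by_contra hcon
    refine hpq (FrameHom.ext fun a => propext ⟨fun hp => ?_, fun hq => ?_⟩)
    · by_contra hq
      exact hcon (key p q a hp hq)
    · by_contra hp
      obtain ⟨s, t, hs, ht, h1, h2, h3⟩ := key q p a hq hp
      exact hcon ⟨t, s, ht, hs, h2, h1, h3.symm⟩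

theorem compactSpace_points (hF : IsCompactFrame F) (hR : IsRegularFrame F) :
    CompactSpace (Locale.PT F) where
  isCompact_univ := by
    rw [isCompact_iff_finite_subcover]
    intro ι U hU hcover
    choose u hu using hU
    -- Spatiality turns a cover of the space of points into a join equal to ⊤ in the frame, where
    -- compactness applies.
    have htop : sSup (Set.range u) = ⊤ := by
      refine top_le_iff.1 (le_of_forall_point hF hR fun p _ => ?_)
      obtain ⟨i, hi⟩ := Set.mem_iUnion.1 (hcover (Set.mem_univ p))
      rw [← hu i] at hi
      exact OrderHomClass.mono p (le_sSup (Set.mem_range_self i)) hi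
    obtain ⟨T, hTS, hT, hTtop⟩ := hF _ htop
    choose i hi using hTS
    classical
    refine ⟨hT.toFinset.attach.image fun t => i (hT.mem_toFinset.1 t.2), fun p _ => ?_⟩
    have hp : p (sSup T) := by
      rw [hTtop, map_top]
      trivial
    rw [map_sSup, sSup_image] at hp
    simp only [iSup_Prop_eq] at hp
    obtain ⟨t, ht, hpt⟩ := hp
    refine Set.mem_iUnion₂.2 ⟨i ht, Finset.mem_image.2
      ⟨⟨t, hT.mem_toFinset.2 ht⟩, Finset.mem_attach _ _, rfl⟩, ?_⟩
    rw [← hu, hi ht]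
    exact hpt

end Points

/-! ### The duality of compact Hausdorff spaces and compact regular frames -/

/-- An isomorphism of compact regular frames from a bijective frame homomorphism. -/
noncomputable def KRFrm.isoOfBijective {A B : KRFrm.{u}} (f : FrameHom A.obj B.obj)
    (hf : Function.Bijective f) : A ≅ B :=
  isCompactRegular.isoMk (Frm.Iso.mk (f.orderIsoOfBijective hf))

/-- Open sets separate the points of a Hausdorff space, so inverse images of opens determine a
continuous map. -/
instance opnKH_faithful : opnKH.{u}.Faithful where
  map_injective h :=
    (compHausToTop.op ⋙ topCatOpToFrm.{u}).map_injective
      (congrArg (isCompactRegular.ι).map h)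

/-- Each `x` gives a completely prime filter `{U | x ∈ φ U}` of opens of `Y`; compact Hausdorff
spaces being sober, it is the neighbourhood filter of a point, which is taken as the image of `x`.
-/
theorem exists_continuousMap_of_frameHom {X Y : Type u} [TopologicalSpace X]
    [TopologicalSpace Y] [CompactSpace Y] [T2Space Y] (φ : FrameHom (Opens Y) (Opens X)) :
    ∃ f : C(X, Y), Opens.comap f = φ := by
  have hpt : ∀ x : X, ∃ y : Y, ∀ U : Opens Y, x ∈ φ U ↔ y ∈ U := by
    intro x
    -- The largest open set outside the filter: `φ` preserves joins, so `V` is itself outside, and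
    -- any point off `V` will serve as the image of `x`.
    let V : Opens Y := sSup {U | x ∉ φ U}
    have hV : x ∉ φ V := by
      rw [map_sSup, Opens.mem_sSup]
      rintro ⟨_, ⟨U, hU, rfl⟩, hx⟩
      exact hU hx
    have hle : ∀ U, x ∉ φ U → U ≤ V := fun U hU => le_sSup hU
    obtain ⟨y, hy⟩ : ∃ y, y ∉ V := by
      by_contra hcon
      push Not at hcon
      refine hV ?_
      rw [show V = ⊤ from top_le_iff.1 fun y _ => hcon y, map_top]
      trivial
    refine ⟨y, fun U => ⟨fun hx => ?_, fun hyU => ?_⟩⟩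
    -- By regularity some `B` well inside `U` is in the filter; its witness `C` is then not, so `C ≤
    -- V`, and `y`, lying in `C ⊔ U` but off `V`, is in `U`.
    · rw [(isCompactRegular_opens Y).2 U, map_sSup, Opens.mem_sSup] at hx
      obtain ⟨_, ⟨B, ⟨C, h1, h2⟩, rfl⟩, hx⟩ := hx
      have hC : C ≤ V := by
        refine hle C fun hxC => ?_
        have : x ∈ φ (C ⊓ B) := by
          rw [map_inf]
          exact ⟨hxC, hx⟩
        rw [h1, map_bot] at this
        exact this
      have hyt : y ∈ C ⊔ U := by
        rw [h2]
        trivial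
      exact hyt.resolve_left fun h => hy (hC h)
    · by_contra hx
      exact hy (hle U hx hyU)
  choose f hf using hpt
  have hpre : ∀ U : Opens Y, f ⁻¹' U = φ U := fun U => Set.ext fun x => (hf x U).symm
  refine ⟨⟨f, continuous_def.2 fun U hU => ?_⟩, FrameHom.ext fun U => Opens.ext (hpre U)⟩
  have := hpre ⟨U, hU⟩
  rw [Opens.coe_mk] at this
  rw [this]
  exact (φ ⟨U, hU⟩).isOpen

instance opnKH_full : opnKH.{u}.Full where
  map_surjective {X Y} g := by
    let φ : FrameHom (Opens X.unop.toTop) (Opens Y.unop.toTop) := g.hom.hom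
    obtain ⟨f, hf⟩ := exists_continuousMap_of_frameHom φ
    refine ⟨(CompHausLike.ofHom _ f).op, ?_⟩
    apply ObjectProperty.hom_ext
    apply Frm.hom_ext
    exact hf

instance opnKH_essSurj : opnKH.{u}.EssSurj where
  mem_essImage F := by
    have := compactSpace_points F.property.1 F.property.2
    have := t2Space_points F.property.2
    exact ⟨op (CompHaus.of (Locale.PT F.obj)),
      ⟨(KRFrm.isoOfBijective (A := F) (B := opnKH.obj (op (CompHaus.of (Locale.PT F.obj))))
        (Locale.counitAppCont (op F.obj))
        (bijective_counitAppCont F.property.1 F.property.2)).symm⟩⟩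

instance opnKH_isEquivalence : opnKH.{u}.IsEquivalence where

/-! ### The natural isomorphism -/

theorem MonFrame.map_box {F F' : Type u} [Order.Frame F] [Order.Frame F'] (f : FrameHom F F')
    (a : F) : MonFrame.map f (MonFrame.box a) = MonFrame.box (f a) :=
  MonFrame.lift_box _ _ (MonFrame.model_comp f) a

theorem MonFrame.map_dia {F F' : Type u} [Order.Frame F] [Order.Frame F'] (f : FrameHom F F')
    (a : F) : MonFrame.map f (MonFrame.dia a) = MonFrame.dia (f a) :=
  MonFrame.lift_dia _ _ (MonFrame.model_comp f) a

namespace MonNhd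

variable {X : Type u} [TopologicalSpace X]

/-- The directed joins are the substantial relations: both combine compactness of `X` with the fact
that a collection is determined by its closed members, and these by their open supersets. -/
theorem model_opens [CompactSpace X] [T2Space X] :
    MonFrame.Model (openBox (X := X)) (openDia (X := X)) where
  box_mono _ _ _ hW := mem_mono _ hW Set.inter_subset_left
  dia_mono _ _ _ hW := fun h =>
    hW (mem_mono _ h (Set.compl_subset_compl.2 Set.subset_union_left))
  box_inf_dia x y h := by
    rw [← le_bot_iff]
    rintro W ⟨h1, h2⟩
    refine h2 (W.mem_mono h1 fun z hz hz' => ?_)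
    have : z ∈ x ⊓ y := ⟨hz, hz'⟩
    rw [h] at this
    exact this
  box_sup_dia x y h := by
    rw [← top_le_iff]
    intro W _
    by_cases hW : (y : Set X)ᶜ ∈ W.1
    · refine Or.inl (W.mem_mono hW fun z hz => ?_)
      have : z ∈ x ⊔ y := by
        rw [h]
        trivial
      exact this.resolve_right hz
    · exact Or.inr hW
  box_sSup A hA hd := by
    apply le_antisymm
    · intro W hW
      -- A closed member inside the directed union is compact, so it already lies in a single `a ∈
      -- A`.
      obtain ⟨c, hcW, hc, hcA⟩ := W.exists_closed hW
      have htop : (⟨cᶜ, hc.isOpen_compl⟩ : Opens X) ⊔ sSup A = ⊤ := by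
        refine top_le_iff.1 fun z _ => ?_
        by_cases hz : z ∈ c
        · exact Or.inr (hcA hz)
        · exact Or.inl hz
      obtain ⟨a, ha, h⟩ := (isCompactRegular_opens X).1.exists_sup_eq_top hA hd htop
      rw [← sSup_image]
      refine Opens.mem_sSup.2 ⟨_, ⟨a, ha, rfl⟩, W.mem_mono hcW fun z hz => ?_⟩
      have hz' : z ∈ (⟨cᶜ, hc.isOpen_compl⟩ : Opens X) ⊔ a := by
        rw [h]
        trivial
      exact hz'.resolve_left fun h' => h' hz
    · exact iSup₂_le fun a ha W hW => W.mem_mono hW (show a ≤ sSup A from le_sSup ha)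
  dia_sSup A hA hd := by
    apply le_antisymm
    · intro W hW
      by_contra hcon
      rw [← sSup_image, Opens.mem_sSup] at hcon
      -- If every `aᶜ` were in `W`, so would be the intersection of the `aᶜ`: any open `b` around it
      -- contains some `aᶜ` by compactness.
      refine hW (W.closed_mem (sSup A).isOpen.isClosed_compl fun b hb hAb => ?_)
      have htop : (⟨b, hb⟩ : Opens X) ⊔ sSup A = ⊤ := by
        refine top_le_iff.1 fun z _ => ?_
        by_cases hz : z ∈ sSup A
        · exact Or.inr hz
        · exact Or.inl (hAb hz)
      obtain ⟨a, ha, h⟩ := (isCompactRegular_opens X).1.exists_sup_eq_top hA hd htop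
      have haW : (a : Set X)ᶜ ∈ W.1 := by
        by_contra haW
        exact hcon ⟨_, ⟨a, ha, rfl⟩, haW⟩
      refine W.mem_mono haW fun z hz => ?_
      have hz' : z ∈ (⟨b, hb⟩ : Opens X) ⊔ a := by
        rw [h]
        trivial
      exact hz'.resolve_right hz
    · exact iSup₂_le fun a ha W hW h =>
        hW (W.mem_mono h (Set.compl_subset_compl.2 (show a ≤ sSup A from le_sSup ha)))

variable (X) in
/-- The homomorphism from the monotone neighbourhood frame of the opens of `X` to the opens of the
monotone neighbourhood space of `X`. -/
def ofMonFrame [CompactSpace X] [T2Space X] : FrameHom (MonFrame (Opens X)) (Opens (MonNhd X)) :=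
  MonFrame.lift openBox openDia model_opens

theorem ofMonFrame_box [CompactSpace X] [T2Space X] (a : Opens X) :
    ofMonFrame X (MonFrame.box a) = openBox a := MonFrame.lift_box _ _ _ a

theorem ofMonFrame_dia [CompactSpace X] [T2Space X] (a : Opens X) :
    ofMonFrame X (MonFrame.dia a) = openDia a := MonFrame.lift_dia _ _ _ a

theorem ofMonFrame_naturality [CompactSpace X] [T2Space X] {Y : Type u} [TopologicalSpace Y]
    [CompactSpace Y] [T2Space Y] (f : C(X, Y)) :
    (ofMonFrame X).comp (MonFrame.map (Opens.comap f)) =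
      (Opens.comap (MonNhd.map f)).comp (ofMonFrame Y) := by
  refine MonFrame.hom_ext (fun a => ?_) (fun a => ?_)
  · rw [FrameHom.comp_apply, FrameHom.comp_apply, MonFrame.map_box, ofMonFrame_box, ofMonFrame_box]
    rfl
  · rw [FrameHom.comp_apply, FrameHom.comp_apply, MonFrame.map_dia, ofMonFrame_dia, ofMonFrame_dia]
    rfl

/-- The point of the monotone neighbourhood space given by a point of the monotone neighbourhood
frame. -/
def ofPoint (p : FrameHom (MonFrame (Opens X)) Prop) : MonNhd X :=
  ⟨{u | ∃ c : Set X, IsClosed c ∧ c ⊆ u ∧ ∀ a : Opens X, c ⊆ a → p (MonFrame.box a)}, by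
    intro u
    constructor
    · rintro ⟨c, hc, hcu, h⟩
      exact ⟨c, hc, hcu, fun a _ hca => ⟨c, hc, hca, h⟩⟩
    · rintro ⟨c, hc, hcu, h⟩
      refine ⟨c, hc, hcu, fun a hca => ?_⟩
      obtain ⟨c', -, hca', h'⟩ := h a a.isOpen hca
      exact h' a hca'⟩

/-! ### Bijectivity of the comparison homomorphism -/

variable [CompactSpace X] [T2Space X]

theorem mem_box_ofPoint (p : FrameHom (MonFrame (Opens X)) Prop) (a : Opens X) :
    ofPoint p ∈ openBox a ↔ p (MonFrame.box a) := by
  constructor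
  · rintro ⟨c, -, hca, h⟩
    exact h a hca
  · intro h
    rw [(isCompactRegular_opens X).2 a,
      MonFrame.box_sSup ⟨⊥, wellInside_bot a⟩ (directedOn_wellInside a)] at h
    simp only [map_iSup, iSup_Prop_eq] at h
    obtain ⟨b, ⟨c, h1, h2⟩, hb⟩ := h
    -- The complement of the witness is a closed set squeezed between `b` and `a`; every open set
    -- around it contains `b`.
    refine ⟨(c : Set X)ᶜ, c.isOpen.isClosed_compl, fun z hz => ?_, fun d hcd => ?_⟩
    · have hz' : z ∈ c ⊔ a := by
        rw [h2]
        trivial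
      exact hz'.resolve_left hz
    · refine OrderHomClass.mono p (MonFrame.box_mono fun z hz => hcd fun hzc => ?_) hb
      have : z ∈ c ⊓ b := ⟨hzc, hz⟩
      rw [h1] at this
      exact this

/-- The two mixed relations make `◇` dual to `□` at `p`. If `p` misses `◇ a`, the covering relation
forces `□ e` for every open `e ⊇ aᶜ`. Conversely, `p` contains `◇ b` for some `b` well inside `a`,
and the disjointness relation forbids `□` of the witness, an open set around `aᶜ`. -/
theorem mem_dia_ofPoint (p : FrameHom (MonFrame (Opens X)) Prop) (a : Opens X) :
    ofPoint p ∈ openDia a ↔ p (MonFrame.dia a) := by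
  constructor
  · intro h
    by_contra hp
    refine h ⟨(a : Set X)ᶜ, a.isOpen.isClosed_compl, subset_rfl, fun e hae => ?_⟩
    have htop : e ⊔ a = ⊤ := by
      refine top_le_iff.1 fun z _ => ?_
      by_cases hz : z ∈ a
      · exact Or.inr hz
      · exact Or.inl (hae hz)
    have h1 : p (MonFrame.box e ⊔ MonFrame.dia a) := by
      rw [MonFrame.box_sup_dia htop, map_top]
      trivial
    rw [map_sup] at h1
    exact h1.resolve_right hp
  · rintro h ⟨c, -, hca, hc⟩
    rw [(isCompactRegular_opens X).2 a,
      MonFrame.dia_sSup ⟨⊥, wellInside_bot a⟩ (directedOn_wellInside a)] at h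
    simp only [map_iSup, iSup_Prop_eq] at h
    obtain ⟨b, ⟨e, h1, h2⟩, hb⟩ := h
    have he : p (MonFrame.box e) := by
      refine hc e fun z hz => ?_
      have hz' : z ∈ e ⊔ a := by
        rw [h2]
        trivial
      exact hz'.resolve_right (hca hz)
    have h3 : p (MonFrame.box e ⊓ MonFrame.dia b) := by
      rw [map_inf]
      exact ⟨he, hb⟩
    rw [MonFrame.box_inf_dia h1, map_bot] at h3
    exact h3

/-- Both sides are frame homomorphisms to `Prop` in `m`, so agreement on generators suffices. -/
theorem mem_ofMonFrame_ofPoint (p : FrameHom (MonFrame (Opens X)) Prop)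
    (m : MonFrame (Opens X)) : ofPoint p ∈ ofMonFrame X m ↔ p m := by
  have h : (Locale.localePointOfSpacePoint _ (ofPoint p)).comp (ofMonFrame X) = p := by
    refine MonFrame.hom_ext (fun a => propext ?_) (fun a => propext ?_)
    · change ofPoint p ∈ ofMonFrame X (MonFrame.box a) ↔ _
      rw [ofMonFrame_box]
      exact mem_box_ofPoint p a
    · change ofPoint p ∈ ofMonFrame X (MonFrame.dia a) ↔ _
      rw [ofMonFrame_dia]
      exact mem_dia_ofPoint p a
  exact iff_of_eq (DFunLike.congr_fun h m)

variable (X) in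
theorem injective_ofMonFrame : Function.Injective (ofMonFrame X) := by
  have hX := isCompactRegular_opens X
  have hle : ∀ m n, ofMonFrame X m = ofMonFrame X n → m ≤ n := by
    intro m n h
    -- Every point of the presented frame factors through `ofMonFrame X`, and points detect its
    -- order.
    refine le_of_forall_point (MonFrame.isCompactFrame hX.1 hX.2)
      (MonFrame.isRegularFrame hX.2) fun p hp => ?_
    rw [← mem_ofMonFrame_ofPoint, ← h, mem_ofMonFrame_ofPoint]
    exact hp
  exact fun m n h => le_antisymm (hle m n h) (hle n m h.symm)

variable (X) in
theorem surjective_ofMonFrame : Function.Surjective (ofMonFrame X) := by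
  rintro ⟨U, hU⟩
  induction hU with
  | basic s hs =>
    rcases hs with ⟨a, ha, rfl⟩ | ⟨a, ha, rfl⟩
    · exact ⟨MonFrame.box ⟨a, ha⟩, ofMonFrame_box _⟩
    · exact ⟨MonFrame.dia ⟨a, ha⟩, ofMonFrame_dia _⟩
  | univ => exact ⟨⊤, map_top _⟩
  | inter s t _ _ hs ht =>
    obtain ⟨m, hm⟩ := hs
    obtain ⟨n, hn⟩ := ht
    refine ⟨m ⊓ n, ?_⟩
    rw [map_inf, hm, hn]
    rfl
  | sUnion S _ ih =>
    choose m hm using ih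
    refine ⟨⨆ s, ⨆ hs, m s hs, ?_⟩
    simp only [map_iSup, hm]
    ext W
    simp only [Opens.coe_iSup, Set.mem_iUnion]
    exact ⟨fun ⟨s, hs, h⟩ => ⟨s, hs, h⟩, fun ⟨s, hs, h⟩ => ⟨s, hs, h⟩⟩

variable (X) in
theorem bijective_ofMonFrame : Function.Bijective (ofMonFrame X) :=
  ⟨injective_ofMonFrame X, surjective_ofMonFrame X⟩

end MonNhd

/-- The natural isomorphism between `M ∘ opn` and `opn ∘ D`. -/
noncomputable def monOpnIso : opnKH.{u} ⋙ monKR.{u} ≅ monKH.{u}.op ⋙ opnKH.{u} :=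
  NatIso.ofComponents
    (fun X => KRFrm.isoOfBijective (A := (opnKH ⋙ monKR).obj X) (B := (monKH.op ⋙ opnKH).obj X)
      (MonNhd.ofMonFrame X.unop.toTop) (MonNhd.bijective_ofMonFrame X.unop.toTop))
    (fun {X Y} f => by
      apply ObjectProperty.hom_ext
      apply Frm.hom_ext
      exact MonNhd.ofMonFrame_naturality (X := Y.unop.toTop) (Y := X.unop.toTop) f.unop.hom.hom)

/-! ### The equivalence of coalgebras and algebras -/

section CoalgebraToAlgebra

variable (η : opnKH.{u} ⋙ monKR.{u} ≅ monKH.{u}.op ⋙ opnKH.{u})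

instance coalgebraToAlgebra_faithful : (coalgebraToAlgebra η.hom).Faithful where
  map_injective {V W f g} h := by
    apply Quiver.Hom.unop_inj
    apply Endofunctor.Coalgebra.ext
    exact Quiver.Hom.op_inj (opnKH.map_injective (congrArg Endofunctor.Algebra.Hom.f h))

/-- The underlying homomorphism lifts along the full functor `opnKH`; the coalgebra square can be
checked after applying the faithful `opnKH` and precomposing with the invertible `η`. -/
instance coalgebraToAlgebra_full : (coalgebraToAlgebra η.hom).Full where
  map_surjective {V W} g := by
    obtain ⟨f, hf⟩ := opnKH.map_surjective (X := op V.unop.V) (Y := op W.unop.V) g.f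
    have hg : monKR.map (opnKH.map f) ≫ η.hom.app (op W.unop.V) ≫ opnKH.map W.unop.str.op =
        (η.hom.app (op V.unop.V) ≫ opnKH.map V.unop.str.op) ≫ opnKH.map f := by
      rw [hf]
      exact g.h
    have hn : monKR.map (opnKH.map f) ≫ η.hom.app (op W.unop.V) =
        η.hom.app (op V.unop.V) ≫ opnKH.map (monKH.map f.unop).op := η.hom.naturality f
    have h : (monKH.map f.unop).op ≫ W.unop.str.op = V.unop.str.op ≫ f := by
      apply opnKH.map_injective
      rw [← cancel_epi (η.hom.app (op V.unop.V)), Functor.map_comp, Functor.map_comp,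
        ← Category.assoc, ← hn, Category.assoc, hg, Category.assoc]
    refine ⟨Quiver.Hom.op ⟨f.unop, congrArg Quiver.Hom.unop h⟩, ?_⟩
    apply Endofunctor.Algebra.ext
    exact hf

instance coalgebraToAlgebra_essSurj : (coalgebraToAlgebra η.hom).EssSurj where
  mem_essImage A := by
    let X : CompHaus.{u} := (opnKH.objPreimage A.a).unop
    let e : opnKH.obj (op X) ≅ A.a := opnKH.objObjPreimageIso A.a
    -- The algebra structure is transported along `e`, `η` is undone, and fullness makes the result
    -- a coalgebra structure on `X`.
    obtain ⟨g, hg⟩ := opnKH.map_surjective (X := op (monKH.obj X)) (Y := op X)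
      (η.inv.app (op X) ≫ monKR.map e.hom ≫ A.str ≫ e.inv)
    refine ⟨op ⟨X, g.unop⟩, ⟨Endofunctor.Algebra.isoMk e ?_⟩⟩
    change monKR.map e.hom ≫ A.str = (η.hom.app (op X) ≫ opnKH.map g) ≫ e.hom
    rw [hg]
    simp

instance coalgebraToAlgebra_isEquivalence : (coalgebraToAlgebra η.hom).IsEquivalence where

end CoalgebraToAlgebra

theorem mainTheorem6 :
    ∃ η : opnKH.{u} ⋙ monKR.{u} ≅ monKH.{u}.op ⋙ opnKH.{u},
      (∀ (X : CompHaus.{u}) (a : Opens X),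
        (η.hom.app (op X)).hom.hom (MonFrame.box a) = MonNhd.openBox a ∧
        (η.hom.app (op X)).hom.hom (MonFrame.dia a) = MonNhd.openDia a) ∧
      ∃ E : (Endofunctor.Coalgebra monKH.{u})ᵒᵖ ≌ Endofunctor.Algebra monKR.{u},
        E.functor = coalgebraToAlgebra η.hom :=
  ⟨monOpnIso,
    fun X a => ⟨MonNhd.ofMonFrame_box (X := X.toTop) a, MonNhd.ofMonFrame_dia (X := X.toTop) a⟩,
    (coalgebraToAlgebra monOpnIso.hom).asEquivalence, rfl⟩
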